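/- For a discrete random variable $U$ let $H(U)=\sum_u \mathbb P(U=u)\log\frac1{\mathbb P(U=u)}$ be its Shannon entropy, and for an $\mathbb R^d$-valued random variable $X$ which is continuous (that is, whose law has a density $f_X$ with respect to Lebesgue measure) let $h(X)=\int_{\mathbb R^d} f_X(x)\log\frac1{f_X(x)}\,dx$ be its differential entropy. Let $(a_{ij})\in\mathbb Z^{n\times m}$ be such that for each $i=1,\dots,n$ the entries $a_{i1},\dots,a_{im}$ of the $i$-th row are relatively prime, i.e. $\gcd(a_{i1},\dots,a_{im})=1$. Let $\alpha_1,\dots,\alpha_n\in\mathbb R$ satisfy $\sum_{i=1}^n\alpha_i=0$, and fix a dimension $d$. Suppose that $$\sum_{i=1}^n \alpha_i\, H\Big(\sum_{j=1}^m a_{ij}U_j\Big)\le 0$$ for all independent $\mathbb Z^d$-valued random variables $U_1,\dots,U_m$ with finite Shannon entropies $H(U_j)$. Then $$\sum_{i=1}^n \alpha_i\, h\Big(\sum_{j=1}^m a_{ij}X_j\Big)\le 0$$ for all independent continuous $\mathbb R^d$-valued random variables $X_1,\dots,X_m$ for which the differential entropies $h\big(\sum_{j=1}^m a_{ij}X_j\big)$,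 $i=1,\dots,n$, exist and are finite. -/

import Mathlib

open MeasureTheory ProbabilityTheory

noncomputable section

/-- The Shannon entropy of a discrete random variable `U`, in nats:
the sum over all values `s` of `P(U = s) * log (1 / P(U = s))`
(`Real.negMulLog p` is `-p * log p`, with value `0` at `p = 0`).
It is meaningful when `HasFiniteShannonEntropy U P` holds. -/
def shannonEntropy {Ω S : Type*} [MeasurableSpace Ω] (U : Ω → S) (P : Measure Ω) : ℝ :=
  ∑' s : S, Real.negMulLog (P.real (U ⁻¹' {s}))

/-- The Shannon entropy of `U` is finite: the series of nonnegative terms defining it converges. -/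
def HasFiniteShannonEntropy {Ω S : Type*} [MeasurableSpace Ω] (U : Ω → S)
    (P : Measure Ω) : Prop :=
  Summable fun s : S => Real.negMulLog (P.real (U ⁻¹' {s}))

/-- The differential entropy of an `ℝ^d`-valued random variable `X` with density `f` with respect
to Lebesgue measure, in nats: the integral of `f * log (1 / f)`.
It is meaningful when `X` has a density and `HasFiniteDifferentialEntropy X P` holds. -/
def differentialEntropy {Ω : Type*} [MeasurableSpace Ω] {d : ℕ} (X : Ω → Fin d → ℝ)
    (P : Measure Ω) : ℝ :=
  ∫ x : Fin d → ℝ, Real.negMulLog (pdf X P volume x).toReal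

/-- The differential entropy of `X` exists and is finite: `f * log (1 / f)` is Lebesgue
integrable, `f` being the density of `X`. -/
def HasFiniteDifferentialEntropy {Ω : Type*} [MeasurableSpace Ω] {d : ℕ} (X : Ω → Fin d → ℝ)
    (P : Measure Ω) : Prop :=
  Integrable (fun x : Fin d → ℝ => Real.negMulLog (pdf X P volume x).toReal) volume

end

/-!
The differential entropy inequality is the limit of the discrete one for the quantizations
`U j = ⌊k X j⌋`, as `k → ∞`.

The role of the gcd condition is that each row `a i` is the first row of a unimodular integer
matrix `M`, with inverse `N` (`exists_unimodular_of_gcd_eq_one`). Since `M` acts on tuples of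
vectors in `ℝ^d` preserving volume, the sum `∑ j, a i j • X j`, which is the first entry of
`intMulVec M X`, has the density
`sumDensity N f x = ∫ w, ∏ j, f j (intMulVec N (x, w) j)`, where `f j` is the density of `X j`
(`map_sum_pi_withDensity`). Since `M` is also a bijection of the lattice, the law of the quantized
sum `∑ j, a i j • U j`, rescaled to a step density on cells of side `1 / k`, is given by the same
formula with each `f j` replaced by its means over cells (`stepSumDensity_eq`).

Suppose first that the `f j` are bounded and vanish outside a ball. By Lebesgue differentiation
these means converge almost everywhere to the `f j`, and dominated convergence, used once
for the marginal in `w` and once for the entropy, shows that the entropies of the step densities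
converge to the differential entropy of the sum (`tendsto_integral_negMulLog_stepSumDensity`). The
entropy of a step density is the Shannon entropy of the quantized sum minus `log (k ^ d)`
(`integral_negMulLog_comp_latticeFloor`), and these logarithms cancel because the `α i` sum
to `0`.

For general `f j`, the densities are restricted to where `‖x‖ ≤ l` and `f j x ≤ l`, and
normalized. Before normalization the density of each sum is then bounded by that of the original
sum and converges to it as `l → ∞`. For `0 ≤ t ≤ s` there is the bound
`|negMulLog t| ≤ s + |negMulLog s|` (`abs_negMulLog_le`), so finiteness of the differential
entropies of the original sums is enough for dominated convergence; the summands themselves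
need not have finite differential entropy.
-/

open Filter Topology Set
open scoped ENNReal

/-! ### Integer matrices acting on tuples -/

/-- The action of an integer matrix on tuples of elements of an additive group. It is used both on
tuples of lattice points and on tuples of vectors in `ℝ^d`. -/
def intMulVec {ι κ G : Type*} [Fintype κ] [AddCommGroup G] (M : Matrix ι κ ℤ) (x : κ → G) :
    ι → G :=
  fun i => ∑ j, M i j • x j

theorem intMulVec_intMulVec {ι κ ν G : Type*} [Fintype κ] [Fintype ν] [AddCommGroup G]
    (M : Matrix ι κ ℤ) (N : Matrix κ ν ℤ) (x : ν → G) :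
    intMulVec M (intMulVec N x) = intMulVec (M * N) x := by
  funext i
  simp only [intMulVec, Matrix.mul_apply, Finset.smul_sum, Finset.sum_smul, smul_smul]
  exact Finset.sum_comm

theorem intMulVec_one {ι G : Type*} [Fintype ι] [DecidableEq ι] [AddCommGroup G] (x : ι → G) :
    intMulVec (1 : Matrix ι ι ℤ) x = x := by
  funext i
  simp [intMulVec, Matrix.one_apply, ite_smul]

/-- A row of relatively prime integers is the first row of a unimodular matrix: the kernel of the
surjective functional `x ↦ ∑ j, a j * x j` is a free direct summand of `ℤ^(r+1)`. -/
theorem exists_unimodular_of_gcd_eq_one {r : ℕ} (a : Fin (r + 1) → ℤ)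
    (ha : Finset.univ.gcd a = 1) :
    ∃ M N : Matrix (Fin (r + 1)) (Fin (r + 1)) ℤ, M * N = 1 ∧ N * M = 1 ∧ M 0 = a := by
  classical
  let φ : (Fin (r + 1) → ℤ) →ₗ[ℤ] ℤ := Fintype.linearCombination ℤ a
  have hφ : ∀ x, φ x = ∑ j, x j * a j := fun x => by
    simp [φ, Fintype.linearCombination_apply]
  obtain ⟨c, hc⟩ : ∃ c : Fin (r + 1) → ℤ, φ c = 1 := by
    obtain ⟨c, hc⟩ := Finset.gcd_eq_sum_mul (s := Finset.univ) (f := a)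
    exact ⟨c, by rw [hφ, ← ha, hc]; exact Finset.sum_congr rfl fun _ _ => mul_comm _ _⟩
  have hs : ∀ (t : ℤ) x, φ (t • x) = t * φ x := fun t x => by rw [map_smul, smul_eq_mul]
  let K := LinearMap.ker φ
  let e₁ : (Fin (r + 1) → ℤ) ≃ₗ[ℤ] ℤ × K :=
    { toFun := fun x => (φ x, ⟨x - φ x • c, by
        rw [LinearMap.mem_ker, map_sub, hs, hc, mul_one, sub_self]⟩)
      invFun := fun p => p.1 • c + p.2
      map_add' := fun x y => Prod.ext (map_add φ x y) <| Subtype.ext <| by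
        simp only [map_add, add_smul, Submodule.coe_add, Prod.snd_add]
        abel
      map_smul' := fun t x => Prod.ext (hs t x) <| Subtype.ext <| by
        simp only [hs, mul_smul, ← smul_sub, Prod.smul_snd, Submodule.coe_smul, RingHom.id_apply]
      left_inv := fun x => by simp
      right_inv := fun p => by
        have hp : φ p.2 = 0 := p.2.2
        have h : φ (p.1 • c + p.2) = p.1 := by rw [map_add, hs, hc, hp, mul_one, add_zero]
        exact Prod.ext h <| Subtype.ext <| by simp only [h, add_sub_cancel_left] }
  have hK : Module.finrank ℤ K = r := by
    have h := e₁.finrank_eq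
    simp only [Module.finrank_prod, Module.finrank_self, Module.finrank_fintype_fun_eq_card,
      Fintype.card_fin] at h
    omega
  let e₂ : K ≃ₗ[ℤ] (Fin r → ℤ) := (Module.finBasisOfFinrankEq ℤ K hK).equivFun
  let e : (Fin (r + 1) → ℤ) ≃ₗ[ℤ] (Fin (r + 1) → ℤ) :=
    (e₁.trans (LinearEquiv.prodCongr (LinearEquiv.refl ℤ ℤ) e₂)).trans
      (Fin.consLinearEquiv ℤ fun _ => ℤ)
  refine ⟨LinearMap.toMatrix' e.toLinearMap, LinearMap.toMatrix' e.symm.toLinearMap, ?_, ?_, ?_⟩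
  · rw [← LinearMap.toMatrix'_comp, LinearEquiv.comp_coe, LinearEquiv.symm_trans_self]
    exact LinearMap.toMatrix'_id
  · rw [← LinearMap.toMatrix'_comp, LinearEquiv.comp_coe, LinearEquiv.self_trans_symm]
    exact LinearMap.toMatrix'_id
  · funext j
    simp [LinearMap.toMatrix'_apply, e, e₁, hφ, Pi.single_apply]

theorem measurable_intMulVec {ι κ : Type*} [Fintype ι] [Fintype κ] {d : ℕ} (M : Matrix ι κ ℤ) :
    Measurable (intMulVec M : (κ → Fin d → ℝ) → ι → Fin d → ℝ) := by
  unfold intMulVec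
  fun_prop

/-- A unimodular matrix acts on tuples of vectors in `ℝ^d` by a volume preserving map. -/
theorem measurePreserving_intMulVec {m d : ℕ} {M N : Matrix (Fin m) (Fin m) ℤ}
    (h : M * N = 1) :
    MeasurePreserving (intMulVec M : (Fin m → Fin d → ℝ) → Fin m → Fin d → ℝ) := by
  let A : (Fin m → ℝ) →ₗ[ℝ] (Fin m → ℝ) := Matrix.toLin' (M.map (Int.cast : ℤ → ℝ))
  let s : (Fin d → Fin m → ℝ) ≃ₗ[ℝ] (Fin m → Fin d → ℝ) :=
    { toFun := fun x i t => x t i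
      invFun := fun x t i => x i t
      map_add' := fun _ _ => rfl
      map_smul' := fun _ _ => rfl }
  let P : (Fin d → Fin m → ℝ) →ₗ[ℝ] (Fin d → Fin m → ℝ) :=
    LinearMap.pi fun t => A ∘ₗ LinearMap.proj t
  let T : (Fin m → Fin d → ℝ) →ₗ[ℝ] (Fin m → Fin d → ℝ) := s ∘ₗ P ∘ₗ s.symm
  have hT : ⇑T = intMulVec M := by
    funext x i t
    simp [T, P, A, s, intMulVec, Matrix.toLin'_apply, Matrix.mulVec, dotProduct]
  have hdet : |LinearMap.det T| = 1 := by
    have h1 : LinearMap.det T = ∏ _t : Fin d, LinearMap.det A := by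
      rw [LinearMap.det_conj, LinearMap.det_pi]
    have h2 : LinearMap.det A = ((M.det : ℤ) : ℝ) := by
      rw [LinearMap.det_toLin']
      exact (Int.cast_det M).symm
    have h3 : |M.det| = 1 := by
      have : M.det * N.det = 1 := by rw [← Matrix.det_mul, h, Matrix.det_one]
      exact Int.isUnit_iff_abs_eq.mp (IsUnit.of_mul_eq_one _ this)
    rw [h1, h2, Finset.prod_const, abs_pow, ← Int.cast_abs, h3]
    simp
  have h0 : LinearMap.det T ≠ 0 := by
    intro h0
    rw [h0] at hdet
    simp at hdet
  refine ⟨measurable_intMulVec M, ?_⟩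
  rw [← hT, Measure.map_linearMap_addHaar_eq_smul_addHaar _ h0, abs_inv, hdet]
  simp

/-! ### Densities of integer linear combinations -/

theorem measurePreserving_cons {r : ℕ} {E : Type*} [MeasurableSpace E]
    (μ : Fin (r + 1) → Measure E) [∀ i, SigmaFinite (μ i)] :
    MeasurePreserving (fun p : E × (Fin r → E) => (Fin.cons p.1 p.2 : Fin (r + 1) → E))
      ((μ 0).prod (Measure.pi fun i => μ i.succ)) (Measure.pi μ) := by
  have h := (measurePreserving_piFinSuccAbove μ 0).symm
  have e : ⇑(MeasurableEquiv.piFinSuccAbove (fun _ : Fin (r + 1) => E) 0).symm =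
      fun p : E × (Fin r → E) => (Fin.cons p.1 p.2 : Fin (r + 1) → E) := by
    funext p
    simp [MeasurableEquiv.piFinSuccAbove_symm_apply, Fin.insertNthEquiv]
  rw [e] at h
  exact h

theorem lintegral_pi_prod {m : ℕ} {E : Type*} [MeasurableSpace E] (μ : Fin m → Measure E)
    [∀ i, SigmaFinite (μ i)] (f : Fin m → E → ℝ≥0∞) (hf : ∀ i, Measurable (f i)) :
    ∫⁻ x, ∏ i, f i (x i) ∂Measure.pi μ = ∏ i, ∫⁻ x, f i x ∂μ i := by
  induction m with
  | zero => simp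
  | succ m ih =>
    rw [← (measurePreserving_cons μ).lintegral_comp (by fun_prop)]
    simp_rw [Fin.prod_univ_succ, Fin.cons_zero, Fin.cons_succ]
    rw [lintegral_prod_mul (f := f 0) (g := fun y : Fin m → E => ∏ i, f i.succ (y i))
      (hf 0).aemeasurable
      (Finset.measurable_prod _ fun i _ => (hf i.succ).comp (measurable_pi_apply i)).aemeasurable,
      ih _ _ fun i => hf _]

theorem pi_withDensity {m : ℕ} {E : Type*} [MeasurableSpace E] (μ : Measure E) [SigmaFinite μ]
    (f : Fin m → E → ℝ≥0∞) (hf : ∀ i, Measurable (f i))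
    [∀ i, SigmaFinite (μ.withDensity (f i))] :
    Measure.pi (fun i => μ.withDensity (f i)) =
      (Measure.pi fun _ => μ).withDensity fun x => ∏ i, f i (x i) := by
  refine Measure.pi_eq fun s hs => ?_
  rw [withDensity_apply _ (MeasurableSet.univ_pi hs), Measure.restrict_pi_pi (fun _ => μ),
    lintegral_pi_prod (fun i => μ.restrict (s i)) f hf]
  exact Finset.prod_congr rfl fun i _ => (withDensity_apply _ (hs i)).symm

/-- Given densities `f j` on `ℝ^d` and the inverse `N` of a unimodular matrix `M`, the density of
`∑ j, M 0 j • X j` for independent `X j` with densities `f j`. It is the first marginal of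
the density of `intMulVec M X`. -/
noncomputable def sumDensity {r d : ℕ} (N : Matrix (Fin (r + 1)) (Fin (r + 1)) ℤ)
    (f : Fin (r + 1) → (Fin d → ℝ) → ℝ≥0∞) (x : Fin d → ℝ) : ℝ≥0∞ :=
  ∫⁻ w : Fin r → Fin d → ℝ,
    ∏ j, f j (intMulVec N (Fin.cons x w : Fin (r + 1) → Fin d → ℝ) j)

theorem measurable_prod_comp_intMulVec_cons {r d : ℕ} (N : Matrix (Fin (r + 1)) (Fin (r + 1)) ℤ)
    {f : Fin (r + 1) → (Fin d → ℝ) → ℝ≥0∞} (hf : ∀ j, Measurable (f j)) :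
    Measurable fun p : (Fin d → ℝ) × (Fin r → Fin d → ℝ) =>
      ∏ j, f j (intMulVec N (Fin.cons p.1 p.2 : Fin (r + 1) → Fin d → ℝ) j) :=
  Finset.measurable_prod _ fun j _ => (hf j).comp <| (measurable_pi_apply j).comp <|
    (measurable_intMulVec N).comp (measurePreserving_cons fun _ => volume).measurable

theorem measurable_sumDensity {r d : ℕ} (N : Matrix (Fin (r + 1)) (Fin (r + 1)) ℤ)
    {f : Fin (r + 1) → (Fin d → ℝ) → ℝ≥0∞} (hf : ∀ j, Measurable (f j)) :
    Measurable (sumDensity N f) :=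
  (measurable_prod_comp_intMulVec_cons N hf).lintegral_prod_right'

theorem map_sum_pi_withDensity {r d : ℕ} {M N : Matrix (Fin (r + 1)) (Fin (r + 1)) ℤ}
    (hMN : M * N = 1) (hNM : N * M = 1)
    {f : Fin (r + 1) → (Fin d → ℝ) → ℝ≥0∞} (hf : ∀ j, Measurable (f j))
    [∀ j, SigmaFinite (volume.withDensity (f j))] :
    (Measure.pi fun j => volume.withDensity (f j)).map (fun x => ∑ j, M 0 j • x j) =
      volume.withDensity (sumDensity N f) := by
  have hS : Measurable fun x : Fin (r + 1) → Fin d → ℝ => ∑ j, M 0 j • x j := by fun_prop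
  ext B hB
  have hF : Measurable fun x : Fin (r + 1) → Fin d → ℝ => ∏ j, f j (x j) := by fun_prop
  have key : ∀ z : Fin (r + 1) → Fin d → ℝ, ∑ j, M 0 j • intMulVec N z j = z 0 := fun z => by
    have := congrFun (intMulVec_intMulVec M N z) 0
    rw [hMN, intMulVec_one] at this
    exact this
  let G := ((fun x : Fin (r + 1) → Fin d → ℝ => ∑ j, M 0 j • x j) ⁻¹' B).indicator
    fun x => ∏ j, f j (x j)
  have hG : Measurable G := hF.indicator (hS hB)
  rw [Measure.map_apply hS hB, pi_withDensity _ _ hf, withDensity_apply _ (hS hB),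
    withDensity_apply _ hB, ← lintegral_indicator (hS hB), ← volume_pi,
    ← (measurePreserving_intMulVec hNM).lintegral_comp hG]
  have hGN := hG.comp (measurable_intMulVec (d := d) N)
  have hcons := measurePreserving_cons (r := r) fun _ => (volume : Measure (Fin d → ℝ))
  change ∫⁻ x, (G ∘ intMulVec N) x ∂(Measure.pi fun _ => volume) = _
  rw [← hcons.lintegral_comp hGN,
    lintegral_prod (fun p : (Fin d → ℝ) × (Fin r → Fin d → ℝ) =>
      (G ∘ intMulVec N) (Fin.cons p.1 p.2 : Fin (r + 1) → Fin d → ℝ))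
      (hGN.comp hcons.measurable).aemeasurable, ← lintegral_indicator hB]
  refine lintegral_congr fun x => ?_
  have hmem : ∀ w : Fin r → Fin d → ℝ,
      intMulVec N (Fin.cons x w : Fin (r + 1) → Fin d → ℝ) ∈
        (fun x : Fin (r + 1) → Fin d → ℝ => ∑ j, M 0 j • x j) ⁻¹' B ↔ x ∈ B := fun w => by
    rw [Set.mem_preimage, key, Fin.cons_zero]
  by_cases hx : x ∈ B
  · rw [Set.indicator_of_mem hx]
    refine lintegral_congr fun w => ?_
    exact (Set.indicator_of_mem ((hmem w).2 hx)
      fun x : Fin (r + 1) → Fin d → ℝ => ∏ j, f j (x j) :)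
  · rw [Set.indicator_of_notMem hx]
    refine (lintegral_congr fun w => ?_).trans lintegral_zero
    exact (Set.indicator_of_notMem (fun h => hx ((hmem w).1 h))
      fun x : Fin (r + 1) → Fin d → ℝ => ∏ j, f j (x j) :)

/-! ### Quantization on the lattice `k⁻¹ ℤ^d` -/

/-- The index `⌊k x⌋` (coordinatewise) of the cell of the lattice `k⁻¹ ℤ^d` that contains `x`. -/
noncomputable def latticeFloor {d : ℕ} (k : ℕ) (x : Fin d → ℝ) : Fin d → ℤ := fun t => ⌊k * x t⌋

/-- The point `u / k` of the lattice `k⁻¹ ℤ^d`. -/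
noncomputable def latticePoint {d : ℕ} (k : ℕ) (u : Fin d → ℤ) : Fin d → ℝ := fun t => u t / k

theorem measurable_latticeFloor {d : ℕ} (k : ℕ) : Measurable (latticeFloor (d := d) k) := by
  unfold latticeFloor
  exact measurable_pi_lambda _ fun t => Int.measurable_floor.comp (by fun_prop)

theorem norm_latticePoint_sub_le {d k : ℕ} (hk : 0 < k) {x : Fin d → ℝ} {u : Fin d → ℤ}
    (h : latticeFloor k x = u) : ‖latticePoint k u - x‖ ≤ (k : ℝ)⁻¹ := by
  have hk' : (0 : ℝ) < k := by exact_mod_cast hk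
  refine (pi_norm_le_iff_of_nonneg (by positivity)).2 fun t => ?_
  rw [← h, Real.norm_eq_abs, Pi.sub_apply, latticePoint, latticeFloor]
  have h1 := Int.floor_le (k * x t)
  have h2 := Int.lt_floor_add_one (k * x t)
  have e : (⌊k * x t⌋ : ℝ) / k - x t = (⌊k * x t⌋ - k * x t) / k := by field_simp
  rw [e, abs_div, abs_of_pos hk', div_eq_mul_inv]
  refine mul_le_of_le_one_left (by positivity) ?_
  rw [abs_le]
  constructor <;> linarith

theorem latticePoint_intMulVec {ι κ : Type*} [Fintype κ] {d : ℕ} (k : ℕ) (M : Matrix ι κ ℤ)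
    (u : κ → Fin d → ℤ) (i : ι) :
    latticePoint k (intMulVec M u i) = intMulVec M (fun j => latticePoint k (u j)) i := by
  funext t
  simp [latticePoint, intMulVec, Finset.sum_div, mul_div_assoc]

theorem norm_intMulVec_le {m d : ℕ} (M : Matrix (Fin m) (Fin m) ℤ) (x : Fin m → Fin d → ℝ)
    {R : ℝ} (hR : 0 ≤ R) (hx : ∀ j, ‖x j‖ ≤ R) (i : Fin m) :
    ‖intMulVec M x i‖ ≤ (∑ i, ∑ j, |(M i j : ℝ)|) * R := by
  calc ‖intMulVec M x i‖ ≤ ∑ j, |(M i j : ℝ)| * R := by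
        refine norm_sum_le_of_le _ fun j _ => ?_
        rw [← Int.cast_smul_eq_zsmul ℝ, norm_smul, Real.norm_eq_abs]
        exact mul_le_mul_of_nonneg_left (hx j) (abs_nonneg _)
    _ = (∑ j, |(M i j : ℝ)|) * R := by rw [Finset.sum_mul]
    _ ≤ _ := by
        refine mul_le_mul_of_nonneg_right ?_ hR
        exact Finset.single_le_sum (f := fun i => ∑ j, |(M i j : ℝ)|)
          (fun i _ => Finset.sum_nonneg fun j _ => abs_nonneg _) (Finset.mem_univ i)

theorem latticeFloor_preimage_singleton {d k : ℕ} (hk : 0 < k) (u : Fin d → ℤ) :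
    latticeFloor k ⁻¹' {u} =
      Set.pi univ fun t => Ico ((u t : ℝ) / k) (((u t : ℝ) + 1) / k) := by
  have hk' : (0 : ℝ) < k := by exact_mod_cast hk
  ext x
  simp only [mem_preimage, mem_singleton_iff, funext_iff, latticeFloor, Int.floor_eq_iff,
    Set.mem_pi, mem_univ, true_implies, mem_Ico, div_le_iff₀ hk', lt_div_iff₀ hk', mul_comm]

theorem volume_latticeFloor_preimage_singleton {d k : ℕ} (hk : 0 < k) (u : Fin d → ℤ) :
    volume (latticeFloor k ⁻¹' {u}) = ((k : ℝ≥0∞) ^ d)⁻¹ := by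
  have hk' : (0 : ℝ) < k := by exact_mod_cast hk
  rw [latticeFloor_preimage_singleton hk, Real.volume_pi_Ico]
  have : ∀ t, ((u t : ℝ) + 1) / k - u t / k = (k : ℝ)⁻¹ := fun t => by ring
  simp [this, ENNReal.ofReal_inv_of_pos hk', ENNReal.inv_pow]

/-- Each cell is, up to a null set, a closed ball for the sup norm. -/
theorem latticeFloor_preimage_singleton_ae_eq {d k : ℕ} (hk : 0 < k) (u : Fin d → ℤ) :
    latticeFloor k ⁻¹' {u} =ᵐ[volume]
      Metric.closedBall (fun t => ((u t : ℝ) + 1 / 2) / k) (1 / 2 / k) := by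
  have hk' : (0 : ℝ) < k := by exact_mod_cast hk
  rw [latticeFloor_preimage_singleton hk, closedBall_pi _ (by positivity)]
  have e : ∀ t, Metric.closedBall (((u t : ℝ) + 1 / 2) / k) (1 / 2 / k) =
      Icc ((u t : ℝ) / k) (((u t : ℝ) + 1) / k) := fun t => by
    rw [Real.closedBall_eq_Icc]
    congr 1 <;> ring
  simp only [e]
  exact Measure.pi_Ico_ae_eq_pi_Icc (μ := fun _ : Fin d => (volume : Measure ℝ))

/-- Volume is carried by quantization to a multiple of the counting measure of the lattice. -/
theorem map_latticeFloor_volume {r d k : ℕ} (hk : 0 < k) :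
    (volume : Measure (Fin r → Fin d → ℝ)).map (fun y l => latticeFloor k (y l)) =
      ((k : ℝ≥0∞) ^ d)⁻¹ ^ r • Measure.count := by
  have hm : Measurable fun (y : Fin r → Fin d → ℝ) l => latticeFloor k (y l) :=
    measurable_pi_lambda _ fun l => (measurable_latticeFloor k).comp (measurable_pi_apply l)
  refine Measure.ext_iff_singleton.2 fun w => ?_
  rw [Measure.map_apply hm (measurableSet_singleton w)]
  have : (fun (y : Fin r → Fin d → ℝ) l => latticeFloor k (y l)) ⁻¹' {w} =
      Set.pi univ fun l => latticeFloor k ⁻¹' {w l} := by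
    ext y
    simp [funext_iff]
  rw [this, volume_pi_pi]
  simp [volume_latticeFloor_preimage_singleton hk]

theorem map_latticeFloor_volume_single {d k : ℕ} (hk : 0 < k) :
    (volume : Measure (Fin d → ℝ)).map (latticeFloor k) =
      ((k : ℝ≥0∞) ^ d)⁻¹ • Measure.count := by
  refine Measure.ext_iff_singleton.2 fun w => ?_
  rw [Measure.map_apply (measurable_latticeFloor k) (measurableSet_singleton w),
    volume_latticeFloor_preimage_singleton hk]
  simp

/-- The mean value of `f` on a cell of the lattice `k⁻¹ ℤ^d`. -/
noncomputable def cellMean {d : ℕ} (k : ℕ) (f : (Fin d → ℝ) → ℝ≥0∞) (u : Fin d → ℤ) : ℝ≥0∞ :=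
  (k : ℝ≥0∞) ^ d * ∫⁻ x in latticeFloor k ⁻¹' {u}, f x

/-- Lebesgue differentiation along cells that need not contain the point `z` but stay
within a bounded number of cells from it. -/
theorem ae_tendsto_cellMean {d : ℕ} {f : (Fin d → ℝ) → ℝ≥0∞} (hf : Measurable f)
    (hfin : ∫⁻ x, f x ≠ ∞) (C : ℝ) :
    ∀ᵐ z, ∀ u : ℕ → Fin d → ℤ, (∀ k, 0 < k → ‖latticePoint k (u k) - z‖ ≤ C * (k : ℝ)⁻¹) →
      Tendsto (fun k => cellMean k f (u k)) atTop (𝓝 (f z)) := by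
  filter_upwards [(IsUnifLocDoublingMeasure.vitaliFamily
    (volume : Measure (Fin d → ℝ)) (2 * C + 1)).ae_tendsto_lintegral_div hf.aemeasurable hfin]
    with z hz u hu
  have hδ : Tendsto (fun k : ℕ => (1 / 2 / (k : ℝ))) atTop (𝓝[>] 0) := by
    refine tendsto_nhdsWithin_iff.2 ⟨tendsto_const_div_atTop_nhds_zero_nat _, ?_⟩
    filter_upwards [eventually_gt_atTop 0] with k hk
    have hk' : (0 : ℝ) < k := by exact_mod_cast hk
    exact mem_Ioi.2 (by positivity)
  have hmem : ∀ᶠ k : ℕ in atTop, z ∈ Metric.closedBall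
      (fun t => ((u k t : ℝ) + 1 / 2) / k) ((2 * C + 1) * (1 / 2 / (k : ℝ))) := by
    filter_upwards [eventually_gt_atTop 0] with k hk
    have hk' : (0 : ℝ) < k := by exact_mod_cast hk
    have h1 := hu k hk
    have h2 : ‖(fun t => ((u k t : ℝ) + 1 / 2) / k) - latticePoint k (u k)‖ ≤ 1 / 2 / k := by
      refine (pi_norm_le_iff_of_nonneg (by positivity)).2 fun t => le_of_eq ?_
      have : ((u k t : ℝ) + 1 / 2) / k - u k t / k = 1 / 2 / k := by ring
      rw [Pi.sub_apply, latticePoint, this, Real.norm_eq_abs, abs_of_pos (by positivity)]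
    rw [Metric.mem_closedBall, dist_comm, dist_eq_norm]
    calc _ ≤ _ := norm_sub_le_norm_sub_add_norm_sub _ (latticePoint k (u k)) _
      _ ≤ 1 / 2 / k + C * (k : ℝ)⁻¹ := add_le_add h2 h1
      _ = _ := by ring
  refine (hz.comp (IsUnifLocDoublingMeasure.tendsto_closedBall_filterAt volume _ _ hδ hmem)).congr'
    ?_
  filter_upwards [eventually_gt_atTop 0] with k hk
  have hae := latticeFloor_preimage_singleton_ae_eq hk (u k)
  simp only [Function.comp_apply]
  rw [← measure_congr hae, ← setLIntegral_congr hae, cellMean,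
    volume_latticeFloor_preimage_singleton hk, ENNReal.div_eq_inv_mul, inv_inv]

theorem cellMean_le {d k : ℕ} (hk : 0 < k) {f : (Fin d → ℝ) → ℝ≥0∞} {C : ℝ≥0∞}
    (hC : ∀ x, f x ≤ C) (u : Fin d → ℤ) : cellMean k f u ≤ C := by
  have h0 : (k : ℝ≥0∞) ^ d ≠ 0 := by simp [hk.ne']
  have h1 : (k : ℝ≥0∞) ^ d ≠ ∞ := ENNReal.pow_ne_top (ENNReal.natCast_ne_top k)
  calc cellMean k f u ≤ (k : ℝ≥0∞) ^ d * ∫⁻ _x in latticeFloor k ⁻¹' {u}, C :=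
        mul_le_mul_right (lintegral_mono fun x => hC x) _
    _ = C := by
        rw [setLIntegral_const, volume_latticeFloor_preimage_singleton hk, mul_left_comm,
          ENNReal.mul_inv_cancel h0 h1, mul_one]

theorem norm_latticePoint_le_of_cellMean_ne_zero {d k : ℕ} (hk : 0 < k)
    {f : (Fin d → ℝ) → ℝ≥0∞} {R : ℝ} (hR : ∀ x, f x ≠ 0 → ‖x‖ ≤ R) {u : Fin d → ℤ}
    (hu : cellMean k f u ≠ 0) : ‖latticePoint k u‖ ≤ R + 1 := by
  obtain ⟨x, hx, hfx⟩ : ∃ x ∈ latticeFloor k ⁻¹' {u}, f x ≠ 0 := by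
    by_contra! h
    refine hu ?_
    rw [cellMean, setLIntegral_congr_fun (measurable_latticeFloor k (measurableSet_singleton u))
      h, lintegral_zero, mul_zero]
  have h1 := norm_latticePoint_sub_le hk hx
  have h2 : ‖latticePoint k u‖ ≤ ‖latticePoint k u - x‖ + ‖x‖ := by
    simpa using norm_add_le (latticePoint k u - x) x
  have h3 : (k : ℝ)⁻¹ ≤ 1 := inv_le_one_of_one_le₀ (by exact_mod_cast hk)
  linarith [hR x hfx]

/-- The step function approximating the density `∏ j, f j (intMulVec N y j)` of
`intMulVec M X`: at `y` it is the rescaled probability that the quantizations of the `X j`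
are the entries of `intMulVec N ⌊k y⌋`. -/
noncomputable def stepDensity {m d : ℕ} (N : Matrix (Fin m) (Fin m) ℤ)
    (f : Fin m → (Fin d → ℝ) → ℝ≥0∞) (k : ℕ) (y : Fin m → Fin d → ℝ) : ℝ≥0∞ :=
  ∏ j, cellMean k (f j) (intMulVec N (fun l => latticeFloor k (y l)) j)

theorem ae_tendsto_stepDensity {m d : ℕ} {M N : Matrix (Fin m) (Fin m) ℤ} (hNM : N * M = 1)
    {f : Fin m → (Fin d → ℝ) → ℝ≥0∞} (hf : ∀ j, Measurable (f j))
    (hfin : ∀ j, ∫⁻ x, f j x ≠ ∞) (hlt : ∀ j x, f j x ≠ ∞) :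
    ∀ᵐ y, Tendsto (fun k => stepDensity N f k y) atTop (𝓝 (∏ j, f j (intMulVec N y j))) := by
  let C : ℝ := ∑ i, ∑ j, |(N i j : ℝ)|
  have h : ∀ᵐ y : Fin m → Fin d → ℝ, ∀ j, ∀ u : ℕ → Fin d → ℤ,
      (∀ k, 0 < k → ‖latticePoint k (u k) - intMulVec N y j‖ ≤ C * (k : ℝ)⁻¹) →
      Tendsto (fun k => cellMean k (f j) (u k)) atTop (𝓝 (f j (intMulVec N y j))) := by
    refine ae_all_iff.2 fun j => ?_
    have hq : Measure.QuasiMeasurePreserving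
        (fun y : Fin m → Fin d → ℝ => intMulVec N y j) volume volume :=
      (Measure.quasiMeasurePreserving_eval (fun _ : Fin m => (volume : Measure (Fin d → ℝ)))
        j).comp (measurePreserving_intMulVec hNM).quasiMeasurePreserving
    exact hq.ae (ae_tendsto_cellMean (hf j) (hfin j) C)
  filter_upwards [h] with y hy
  refine ENNReal.tendsto_finsetProd_of_ne_top _ (fun j _ => hy j _ fun k hk => ?_)
    fun j _ => hlt j _
  have e : intMulVec N (fun l => latticePoint k (latticeFloor k (y l))) j - intMulVec N y j =
      intMulVec N (fun l => latticePoint k (latticeFloor k (y l)) - y l) j := by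
    simp [intMulVec, smul_sub, Finset.sum_sub_distrib]
  rw [latticePoint_intMulVec, e]
  exact norm_intMulVec_le N _ (by positivity) (fun l => norm_latticePoint_sub_le hk rfl) j

theorem stepDensity_le {m d k : ℕ} (hk : 0 < k) (N : Matrix (Fin m) (Fin m) ℤ)
    {f : Fin m → (Fin d → ℝ) → ℝ≥0∞} {C : ℝ≥0∞} (hC : ∀ j x, f j x ≤ C)
    (y : Fin m → Fin d → ℝ) : stepDensity N f k y ≤ C ^ m := by
  calc stepDensity N f k y ≤ ∏ _j : Fin m, C :=
        Finset.prod_le_prod' fun j _ => cellMean_le hk (hC j) _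
    _ = C ^ m := by simp

/-- The supports of the step functions are bounded uniformly in the scale `k`. -/
theorem norm_le_of_stepDensity_ne_zero {m d k : ℕ} (hk : 0 < k) {M N : Matrix (Fin m) (Fin m) ℤ}
    (hMN : M * N = 1) {f : Fin m → (Fin d → ℝ) → ℝ≥0∞} {R : ℝ} (hR0 : 0 ≤ R)
    (hR : ∀ j x, f j x ≠ 0 → ‖x‖ ≤ R) {y : Fin m → Fin d → ℝ} (hy : stepDensity N f k y ≠ 0)
    (l : Fin m) : ‖y l‖ ≤ (∑ i, ∑ j, |(M i j : ℝ)|) * (R + 1) + 1 := by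
  let v : Fin m → Fin d → ℤ := fun l => latticeFloor k (y l)
  have h1 : ∀ j, ‖latticePoint k (intMulVec N v j)‖ ≤ R + 1 := fun j =>
    norm_latticePoint_le_of_cellMean_ne_zero hk (hR j)
      (Finset.prod_ne_zero_iff.1 hy j (Finset.mem_univ j))
  have h2 := norm_intMulVec_le M (fun j => latticePoint k (intMulVec N v j)) (by positivity) h1 l
  rw [← latticePoint_intMulVec, intMulVec_intMulVec, hMN, intMulVec_one] at h2
  have h3 : ‖latticePoint k (v l) - y l‖ ≤ (k : ℝ)⁻¹ := norm_latticePoint_sub_le hk rfl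
  have h4 : (k : ℝ)⁻¹ ≤ 1 := inv_le_one_of_one_le₀ (by exact_mod_cast hk)
  have h5 : ‖y l‖ ≤ ‖latticePoint k (v l)‖ + ‖latticePoint k (v l) - y l‖ := by
    have := norm_sub_le (latticePoint k (v l)) (latticePoint k (v l) - y l)
    simpa using this
  linarith

/-! ### The law and the entropy of the quantized sum -/

/-- The first marginal of `stepDensity N f k`. -/
noncomputable def stepSumDensity {r d : ℕ} (N : Matrix (Fin (r + 1)) (Fin (r + 1)) ℤ)
    (f : Fin (r + 1) → (Fin d → ℝ) → ℝ≥0∞) (k : ℕ) (x : Fin d → ℝ) : ℝ≥0∞ :=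
  ∫⁻ w : Fin r → Fin d → ℝ, stepDensity N f k (Fin.cons x w : Fin (r + 1) → Fin d → ℝ)

/-- The marginal step function is the rescaled law of the quantized sum: unimodularity turns the
event that the sum equals `v` into the disjoint union, over the remaining coordinates `w`,
of the events that the quantizations are the entries of `intMulVec N (Fin.cons v w)`. -/
theorem stepSumDensity_eq {r d k : ℕ} (hk : 0 < k) {M N : Matrix (Fin (r + 1)) (Fin (r + 1)) ℤ}
    (hMN : M * N = 1) (hNM : N * M = 1) (f : Fin (r + 1) → (Fin d → ℝ) → ℝ≥0∞)
    [∀ j, SigmaFinite (volume.withDensity (f j))] (x : Fin d → ℝ) :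
    stepSumDensity N f k x = (k : ℝ≥0∞) ^ d *
      (Measure.pi fun j => volume.withDensity (f j))
        ((fun z : Fin (r + 1) → Fin d → ℝ => ∑ j, M 0 j • latticeFloor k (z j)) ⁻¹'
          {latticeFloor k x}) := by
  have h0 : (k : ℝ≥0∞) ^ d ≠ 0 := by simp [hk.ne']
  have h1 : (k : ℝ≥0∞) ^ d ≠ ∞ := ENNReal.pow_ne_top (ENNReal.natCast_ne_top k)
  set v := latticeFloor k x with hv
  let u : (Fin r → Fin d → ℤ) → Fin (r + 1) → Fin d → ℤ := fun w =>
    intMulVec N (Fin.cons v w : Fin (r + 1) → Fin d → ℤ)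
  have hMu : ∀ w, intMulVec M (u w) = Fin.cons v w := fun w => by
    rw [intMulVec_intMulVec, hMN, intMulVec_one]
  let s : (Fin r → Fin d → ℤ) → Set (Fin (r + 1) → Fin d → ℝ) := fun w =>
    Set.pi univ fun j => latticeFloor k ⁻¹' {u w j}
  have hs : ∀ w z, z ∈ s w ↔ (fun j => latticeFloor k (z j)) = u w := fun w z => by
    simp [s, funext_iff]
  have hunion : (fun z : Fin (r + 1) → Fin d → ℝ => ∑ j, M 0 j • latticeFloor k (z j)) ⁻¹' {v} =
      ⋃ w, s w := by
    ext z
    simp only [mem_preimage, mem_singleton_iff, mem_iUnion, hs]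
    constructor
    · intro hz
      refine ⟨Fin.tail (intMulVec M fun j => latticeFloor k (z j)), ?_⟩
      have : (Fin.cons v (Fin.tail (intMulVec M fun j => latticeFloor k (z j))) :
          Fin (r + 1) → Fin d → ℤ) = intMulVec M fun j => latticeFloor k (z j) := by
        conv_rhs => rw [← Fin.cons_self_tail (intMulVec M fun j => latticeFloor k (z j))]
        rw [← hz]
        rfl
      simp only [u]
      rw [this, intMulVec_intMulVec, hNM, intMulVec_one]
    · rintro ⟨w, hw⟩
      have := congrFun (hMu w) 0
      rw [← hw, Fin.cons_zero] at this
      exact this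
  have hdisj : Pairwise (Function.onFun Disjoint s) := fun w w' hww => by
    refine Set.disjoint_left.2 fun z hz hz' => hww ?_
    have h := hMu w
    rw [← (hs w z).1 hz, (hs w' z).1 hz', hMu] at h
    exact (Fin.cons_right_injective _ h).symm
  have hmeas : ∀ w, MeasurableSet (s w) := fun w =>
    MeasurableSet.univ_pi fun j => measurable_latticeFloor k (measurableSet_singleton _)
  have hcell : ∀ w, ∏ j, cellMean k (f j) (u w j) = ((k : ℝ≥0∞) ^ d) ^ (r + 1) *
      (Measure.pi fun j => volume.withDensity (f j)) (s w) := fun w => by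
    simp only [s, Measure.pi_pi, cellMean, Finset.prod_mul_distrib, Finset.prod_const,
      Finset.card_univ, Fintype.card_fin]
    congr 1
    exact Finset.prod_congr rfl fun j _ =>
      (withDensity_apply _ (measurable_latticeFloor k (measurableSet_singleton _))).symm
  have hm : Measurable fun (y : Fin r → Fin d → ℝ) l => latticeFloor k (y l) :=
    measurable_pi_lambda _ fun l => (measurable_latticeFloor k).comp (measurable_pi_apply l)
  have hstep : stepSumDensity N f k x = ∫⁻ y : Fin r → Fin d → ℝ,
      (fun w => ∏ j, cellMean k (f j) (u w j)) fun l => latticeFloor k (y l) := by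
    refine lintegral_congr fun y => Finset.prod_congr rfl fun j _ => ?_
    congr 2
    funext l
    refine Fin.cases ?_ (fun i => ?_) l <;> simp [hv]
  rw [hstep, ← lintegral_map (f := fun w => ∏ j, cellMean k (f j) (u w j))
    (Measurable.of_discrete) hm, map_latticeFloor_volume hk, lintegral_smul_measure,
    lintegral_count, hunion, measure_iUnion hdisj hmeas]
  simp only [hcell, ENNReal.tsum_mul_left, smul_eq_mul]
  rw [← mul_assoc, pow_succ, ← mul_assoc, ← mul_pow, ENNReal.inv_mul_cancel h0 h1, one_pow,
    one_mul]

theorem latticeFloor_latticePoint {d k : ℕ} (hk : 0 < k) (u : Fin d → ℤ) :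
    latticeFloor k (latticePoint k u) = u := by
  have hk' : (k : ℝ) ≠ 0 := by exact_mod_cast hk.ne'
  funext t
  simp [latticeFloor, latticePoint, mul_div_cancel₀ _ hk']

theorem finite_norm_latticePoint_le {d k : ℕ} (hk : 0 < k) (R : ℝ) :
    {u : Fin d → ℤ | ‖latticePoint k u‖ ≤ R}.Finite := by
  have hk' : (0 : ℝ) < k := by exact_mod_cast hk
  refine (Set.finite_Icc (fun _ => -⌈R * k⌉) (fun _ => ⌈R * k⌉)).subset fun u hu => ?_
  have h : ∀ t, |(u t : ℝ)| ≤ R * k := fun t => by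
    have := (norm_le_pi_norm (latticePoint k u) t).trans hu
    rwa [Real.norm_eq_abs, latticePoint, abs_div, abs_of_pos hk', div_le_iff₀ hk'] at this
  refine ⟨fun t => ?_, fun t => ?_⟩
  · have h1 := (abs_le.1 (h t)).1
    have h2 := Int.le_ceil (R * k)
    have : ((-⌈R * k⌉ : ℤ) : ℝ) ≤ u t := by push_cast; linarith
    exact_mod_cast this
  · have h1 := (abs_le.1 (h t)).2
    have h2 := Int.le_ceil (R * k)
    exact_mod_cast h1.trans h2

theorem measurable_stepDensity {m d : ℕ} (N : Matrix (Fin m) (Fin m) ℤ)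
    (f : Fin m → (Fin d → ℝ) → ℝ≥0∞) (k : ℕ) : Measurable (stepDensity N f k) := by
  have hm : Measurable fun (y : Fin m → Fin d → ℝ) l => latticeFloor k (y l) :=
    measurable_pi_lambda _ fun l => (measurable_latticeFloor k).comp (measurable_pi_apply l)
  exact (Measurable.of_discrete (f := fun u : Fin m → Fin d → ℤ =>
    ∏ j, cellMean k (f j) (intMulVec N u j))).comp hm

theorem measurable_stepDensity_cons {r d : ℕ} (N : Matrix (Fin (r + 1)) (Fin (r + 1)) ℤ)
    (f : Fin (r + 1) → (Fin d → ℝ) → ℝ≥0∞) (k : ℕ) :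
    Measurable fun p : (Fin d → ℝ) × (Fin r → Fin d → ℝ) =>
      stepDensity N f k (Fin.cons p.1 p.2 : Fin (r + 1) → Fin d → ℝ) :=
  (measurable_stepDensity N f k).comp (measurePreserving_cons fun _ => volume).measurable

theorem measurable_stepSumDensity {r d : ℕ} (N : Matrix (Fin (r + 1)) (Fin (r + 1)) ℤ)
    (f : Fin (r + 1) → (Fin d → ℝ) → ℝ≥0∞) (k : ℕ) : Measurable (stepSumDensity N f k) :=
  (measurable_stepDensity_cons N f k).lintegral_prod_right'

theorem norm_le_of_stepSumDensity_ne_zero {r d k : ℕ} (hk : 0 < k)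
    {M N : Matrix (Fin (r + 1)) (Fin (r + 1)) ℤ} (hMN : M * N = 1)
    {f : Fin (r + 1) → (Fin d → ℝ) → ℝ≥0∞} {R : ℝ} (hR0 : 0 ≤ R)
    (hR : ∀ j x, f j x ≠ 0 → ‖x‖ ≤ R) {x : Fin d → ℝ} (hx : stepSumDensity N f k x ≠ 0) :
    ‖x‖ ≤ (∑ i, ∑ j, |(M i j : ℝ)|) * (R + 1) + 1 := by
  obtain ⟨w, hw⟩ : ∃ w : Fin r → Fin d → ℝ,
      stepDensity N f k (Fin.cons x w : Fin (r + 1) → Fin d → ℝ) ≠ 0 := by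
    by_contra! h
    exact hx (by simp [stepSumDensity, h])
  exact norm_le_of_stepDensity_ne_zero hk hMN hR0 hR hw 0

/-- The entropy of a `ℤ^d`-valued random variable `V` with finitely many values, up to the shift
`d * log k`, is the differential entropy of the step density on cells of side `1 / k`. -/
theorem integral_negMulLog_comp_latticeFloor {Ω : Type*} [MeasurableSpace Ω] (P : Measure Ω)
    [IsProbabilityMeasure P] {d k : ℕ} (hk : 0 < k) {V : Ω → Fin d → ℤ} (hV : Measurable V)
    (hfin : {v | P.real (V ⁻¹' {v}) ≠ 0}.Finite) :
    ∫ x : Fin d → ℝ, Real.negMulLog ((k : ℝ) ^ d * P.real (V ⁻¹' {latticeFloor k x})) =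
      shannonEntropy V P - Real.log ((k : ℝ) ^ d) := by
  have hk' : (0 : ℝ) < (k : ℝ) ^ d := by
    have : (0 : ℝ) < k := by exact_mod_cast hk
    positivity
  let p : (Fin d → ℤ) → ℝ := fun v => P.real (V ⁻¹' {v})
  have hsum : ∀ g : (Fin d → ℤ) → ℝ, (∀ v, p v = 0 → g v = 0) → Summable g := fun g hg =>
    summable_of_hasFiniteSupport (hfin.subset fun v hv hp => hv (hg v hp))
  have hone : ∑' v, p v = 1 := by
    have : ∀ v, p v = ((P.map V) {v}).toReal := fun v => by
      rw [Measure.map_apply hV (measurableSet_singleton v)]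
      rfl
    have hmap : IsProbabilityMeasure (P.map V) := Measure.isProbabilityMeasure_map hV.aemeasurable
    simp only [this]
    rw [← ENNReal.tsum_toReal_eq fun v => measure_ne_top _ _]
    have h2 := Measure.tsum_indicator_apply_singleton (P.map V) univ MeasurableSet.univ
    simp only [indicator_univ, measure_univ] at h2
    rw [h2, ENNReal.toReal_one]
  let g : (Fin d → ℤ) → ℝ := fun v => Real.negMulLog ((k : ℝ) ^ d * p v)
  have hg : Summable g := hsum g fun v hv => by simp [g, hv]
  have hgi : Integrable g Measure.count := by
    rw [integrable_count_iff]
    exact hg.norm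
  have hint : ∫ v, g v ∂Measure.count = ∑' v, g v := by
    rw [integral_countable hgi]
    simp [Measure.real]
  have key : ∫ x : Fin d → ℝ, g (latticeFloor k x) = ((k : ℝ) ^ d)⁻¹ * ∑' v, g v := by
    rw [← integral_map (measurable_latticeFloor k).aemeasurable
      (Measurable.of_discrete (f := g)).aestronglyMeasurable,
      map_latticeFloor_volume_single hk, integral_smul_measure, hint]
    simp
  have hterm : ∀ v, g v = p v * Real.negMulLog ((k : ℝ) ^ d) +
      (k : ℝ) ^ d * Real.negMulLog (p v) := fun v => Real.negMulLog_mul _ _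
  have hH : ∑' v, Real.negMulLog (p v) = shannonEntropy V P := rfl
  change ∫ x : Fin d → ℝ, g (latticeFloor k x) = _
  rw [key, tsum_congr hterm, Summable.tsum_add (hsum _ fun v hv => by simp [hv])
    (hsum _ fun v hv => by simp [hv]), tsum_mul_right, tsum_mul_left, hone, hH]
  simp only [Real.negMulLog]
  field_simp
  ring

/-! ### Convergence of the quantized entropies -/

theorem ae_tendsto_stepSumDensity {r d : ℕ} {M N : Matrix (Fin (r + 1)) (Fin (r + 1)) ℤ}
    (hMN : M * N = 1) (hNM : N * M = 1) {f : Fin (r + 1) → (Fin d → ℝ) → ℝ≥0∞}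
    (hf : ∀ j, Measurable (f j)) (hfin : ∀ j, ∫⁻ x, f j x ≠ ∞) {C : ℝ≥0∞} (hCtop : C ≠ ∞)
    (hC : ∀ j x, f j x ≤ C) {R : ℝ} (hR0 : 0 ≤ R) (hR : ∀ j x, f j x ≠ 0 → ‖x‖ ≤ R) :
    ∀ᵐ x, Tendsto (fun k => stepSumDensity N f k x) atTop (𝓝 (sumDensity N f x)) := by
  have h := ae_tendsto_stepDensity hNM hf hfin fun j x => ne_top_of_le_ne_top hCtop (hC j x)
  have hcons := measurePreserving_cons (r := r) fun _ => (volume : Measure (Fin d → ℝ))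
  have h2 := Measure.ae_ae_of_ae_prod (hcons.quasiMeasurePreserving.ae h)
  let R' : ℝ := (∑ i, ∑ j, |(M i j : ℝ)|) * (R + 1) + 1
  filter_upwards [h2] with x hx
  refine tendsto_lintegral_filter_of_dominated_convergence
    ((Metric.closedBall (0 : Fin r → Fin d → ℝ) R').indicator fun _ => C ^ (r + 1)) ?_ ?_ ?_ hx
  · refine Eventually.of_forall fun k => ?_
    have hx : Measurable fun w : Fin r → Fin d → ℝ => (x, w) := measurable_prodMk_left
    exact ((measurable_stepDensity_cons N f k).comp hx :)
  · filter_upwards [eventually_gt_atTop 0] with k hk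
    refine Eventually.of_forall fun w => ?_
    by_cases h0 : stepDensity N f k (Fin.cons x w : Fin (r + 1) → Fin d → ℝ) = 0
    · rw [h0]
      exact zero_le
    · have hw : w ∈ Metric.closedBall (0 : Fin r → Fin d → ℝ) R' := by
        rw [mem_closedBall_zero_iff]
        refine (pi_norm_le_iff_of_nonneg (by positivity)).2 fun l => ?_
        exact norm_le_of_stepDensity_ne_zero hk hMN hR0 hR h0 l.succ
      rw [indicator_of_mem hw]
      exact stepDensity_le hk N hC _
  · rw [lintegral_indicator Metric.isClosed_closedBall.measurableSet, setLIntegral_const]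
    exact ENNReal.mul_ne_top (ENNReal.pow_ne_top hCtop)
      (isCompact_closedBall _ _).measure_lt_top.ne

theorem stepSumDensity_le {r d k : ℕ} (hk : 0 < k) {M N : Matrix (Fin (r + 1)) (Fin (r + 1)) ℤ}
    (hMN : M * N = 1) {f : Fin (r + 1) → (Fin d → ℝ) → ℝ≥0∞} {C : ℝ≥0∞}
    (hC : ∀ j x, f j x ≤ C) {R : ℝ} (hR0 : 0 ≤ R) (hR : ∀ j x, f j x ≠ 0 → ‖x‖ ≤ R)
    (x : Fin d → ℝ) :
    stepSumDensity N f k x ≤ C ^ (r + 1) * volume (Metric.closedBall (0 : Fin r → Fin d → ℝ)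
      ((∑ i, ∑ j, |(M i j : ℝ)|) * (R + 1) + 1)) := by
  rw [← setLIntegral_const, ← lintegral_indicator Metric.isClosed_closedBall.measurableSet]
  refine lintegral_mono fun w => ?_
  by_cases h0 : stepDensity N f k (Fin.cons x w : Fin (r + 1) → Fin d → ℝ) = 0
  · rw [h0]
    exact zero_le
  · rw [indicator_of_mem]
    · exact stepDensity_le hk N hC _
    · rw [mem_closedBall_zero_iff]
      refine (pi_norm_le_iff_of_nonneg (by positivity)).2 fun l => ?_
      exact norm_le_of_stepDensity_ne_zero hk hMN hR0 hR h0 l.succ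

/-- Entropies of uniformly bounded densities with uniformly bounded supports converge when the
densities converge almost everywhere. -/
theorem tendsto_integral_negMulLog_stepSumDensity {r d : ℕ}
    {M N : Matrix (Fin (r + 1)) (Fin (r + 1)) ℤ}
    (hMN : M * N = 1) (hNM : N * M = 1) {f : Fin (r + 1) → (Fin d → ℝ) → ℝ≥0∞}
    (hf : ∀ j, Measurable (f j)) (hfin : ∀ j, ∫⁻ x, f j x ≠ ∞) {C : ℝ≥0∞} (hCtop : C ≠ ∞)
    (hC : ∀ j x, f j x ≤ C) {R : ℝ} (hR0 : 0 ≤ R) (hR : ∀ j x, f j x ≠ 0 → ‖x‖ ≤ R) :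
    Tendsto (fun k => ∫ x, Real.negMulLog (stepSumDensity N f k x).toReal) atTop
      (𝓝 (∫ x, Real.negMulLog (sumDensity N f x).toReal)) := by
  let R' : ℝ := (∑ i, ∑ j, |(M i j : ℝ)|) * (R + 1) + 1
  let K : ℝ≥0∞ := C ^ (r + 1) * volume (Metric.closedBall (0 : Fin r → Fin d → ℝ) R')
  have hK : K ≠ ∞ := ENNReal.mul_ne_top (ENNReal.pow_ne_top hCtop)
    (isCompact_closedBall _ _).measure_lt_top.ne
  have hle : ∀ k, 0 < k → ∀ x, stepSumDensity N f k x ≤ K := fun k hk x =>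
    stepSumDensity_le hk hMN hC hR0 hR x
  obtain ⟨B, hB⟩ := (isCompact_Icc (a := (0 : ℝ)) (b := K.toReal)).exists_bound_of_continuousOn
    Real.continuous_negMulLog.continuousOn
  refine tendsto_integral_filter_of_dominated_convergence
    ((Metric.closedBall (0 : Fin d → ℝ) R').indicator fun _ => B) ?_ ?_ ?_ ?_
  · exact Eventually.of_forall fun k => (Real.continuous_negMulLog.measurable.comp
      (measurable_stepSumDensity N f k).ennreal_toReal).aestronglyMeasurable
  · filter_upwards [eventually_gt_atTop 0] with k hk
    refine Eventually.of_forall fun x => ?_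
    have hb : ‖Real.negMulLog (stepSumDensity N f k x).toReal‖ ≤ B :=
      hB _ ⟨ENNReal.toReal_nonneg, ENNReal.toReal_mono hK (hle k hk x)⟩
    by_cases h0 : stepSumDensity N f k x = 0
    · rw [h0] at hb ⊢
      refine le_trans (by simp) (indicator_nonneg (fun _ _ => (norm_nonneg _).trans hb) _)
    · rw [indicator_of_mem]
      · exact hb
      · rw [mem_closedBall_zero_iff]
        exact norm_le_of_stepSumDensity_ne_zero hk hMN hR0 hR h0
  · exact (integrable_indicator_iff Metric.isClosed_closedBall.measurableSet).2
      (integrableOn_const (isCompact_closedBall _ _).measure_lt_top.ne)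
  · filter_upwards [ae_tendsto_stepSumDensity hMN hNM hf hfin hCtop hC hR0 hR] with x hx
    have htop : sumDensity N f x ≠ ∞ := by
      refine ne_top_of_le_ne_top hK (le_of_tendsto hx ?_)
      filter_upwards [eventually_gt_atTop 0] with k hk using hle k hk x
    exact (Real.continuous_negMulLog.tendsto _).comp ((ENNReal.tendsto_toReal htop).comp hx)

/-! ### Bounded densities with bounded supports -/

theorem isProbabilityMeasure_withDensity {E : Type*} [MeasurableSpace E] {μ : Measure E}
    {f : E → ℝ≥0∞} (hf : ∫⁻ x, f x ∂μ = 1) : IsProbabilityMeasure (μ.withDensity f) :=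
  ⟨by rw [withDensity_apply _ MeasurableSet.univ, Measure.restrict_univ, hf]⟩

/-- The differential inequality for independent variables with bounded densities vanishing outside
a ball: it is the limit of the discrete inequality for the quantized variables, the terms
`log (k ^ d)` cancelling because `∑ i, α i = 0`. -/
theorem sum_integral_negMulLog_le_of_bounded {n r d : ℕ} (a : Fin n → Fin (r + 1) → ℤ)
    (α : Fin n → ℝ) (hα : ∑ i, α i = 0)
    (hdiscrete : ∀ (Ω : Type) [MeasurableSpace Ω] (P : Measure Ω) [IsProbabilityMeasure P]
      (U : Fin (r + 1) → Ω → (Fin d → ℤ)),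
      (∀ j, Measurable (U j)) → iIndepFun U P →
      (∀ j, HasFiniteShannonEntropy (U j) P) →
      ∑ i, α i * shannonEntropy (fun ω => ∑ j, a i j • U j ω) P ≤ 0)
    {M N : Fin n → Matrix (Fin (r + 1)) (Fin (r + 1)) ℤ} (hMN : ∀ i, M i * N i = 1)
    (hNM : ∀ i, N i * M i = 1) (hM : ∀ i, M i 0 = a i)
    {f : Fin (r + 1) → (Fin d → ℝ) → ℝ≥0∞} (hf : ∀ j, Measurable (f j))
    (hone : ∀ j, ∫⁻ x, f j x = 1) {C : ℝ≥0∞} (hCtop : C ≠ ∞)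
    (hC : ∀ j x, f j x ≤ C) {R : ℝ} (hR0 : 0 ≤ R) (hR : ∀ j x, f j x ≠ 0 → ‖x‖ ≤ R) :
    ∑ i, α i * ∫ x, Real.negMulLog (sumDensity (N i) f x).toReal ≤ 0 := by
  have hprob := fun j => isProbabilityMeasure_withDensity (hone j)
  let P : Measure (Fin (r + 1) → Fin d → ℝ) := Measure.pi fun j => volume.withDensity (f j)
  have hP : IsProbabilityMeasure P := Measure.pi.instIsProbabilityMeasure _
  have hlim := tendsto_finsetSum Finset.univ fun i (_ : i ∈ Finset.univ) =>
    (tendsto_integral_negMulLog_stepSumDensity (hMN i) (hNM i) hf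
      (fun j => by simp [hone j]) hCtop hC hR0 hR).const_mul (α i)
  refine le_of_tendsto hlim ?_
  filter_upwards [eventually_gt_atTop 0] with k hk
  let U : Fin (r + 1) → (Fin (r + 1) → Fin d → ℝ) → Fin d → ℤ := fun j z => latticeFloor k (z j)
  have hU : ∀ j, Measurable (U j) := fun j =>
    (measurable_latticeFloor k).comp (measurable_pi_apply j)
  have hindep : iIndepFun U P := iIndepFun_pi fun _ => (measurable_latticeFloor k).aemeasurable
  have hent : ∀ j, HasFiniteShannonEntropy (U j) P := fun j => by
    refine summable_of_hasFiniteSupport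
      ((finite_norm_latticePoint_le hk (R + 1)).subset fun u hu => ?_)
    refine norm_latticePoint_le_of_cellMean_ne_zero hk (hR j) fun h0 => hu ?_
    have hcell : MeasurableSet (latticeFloor (d := d) k ⁻¹' {u}) :=
      measurable_latticeFloor k (measurableSet_singleton u)
    have h1 : P (U j ⁻¹' {u}) = ∫⁻ x in latticeFloor k ⁻¹' {u}, f j x := by
      rw [← withDensity_apply _ hcell]
      exact (measurePreserving_eval (fun j => volume.withDensity (f j)) j).measure_preimage
        hcell.nullMeasurableSet
    have h2 : ∫⁻ x in latticeFloor k ⁻¹' {u}, f j x = 0 :=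
      (mul_eq_zero.1 h0).resolve_left (by simp [hk.ne'])
    simp [Measure.real, h1, h2]
  have hdisc := hdiscrete _ P U hU hindep hent
  have hterm : ∀ i, ∫ x, Real.negMulLog (stepSumDensity (N i) f k x).toReal =
      shannonEntropy (fun ω => ∑ j, a i j • U j ω) P - Real.log ((k : ℝ) ^ d) := fun i => by
    have hV : Measurable fun ω => ∑ j, a i j • U j ω := by
      have : Measurable fun ω j => U j ω := measurable_pi_lambda _ hU
      exact (Measurable.of_discrete (f := fun u : Fin (r + 1) → Fin d → ℤ =>
        ∑ j, a i j • u j)).comp this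
    have hstep := stepSumDensity_eq hk (hMN i) (hNM i) f
    rw [hM i] at hstep
    rw [← integral_negMulLog_comp_latticeFloor P hk hV]
    · refine integral_congr_ae (Eventually.of_forall fun x => ?_)
      simp only [hstep, ENNReal.toReal_mul, ENNReal.toReal_pow, ENNReal.toReal_natCast]
      rfl
    · refine (finite_norm_latticePoint_le hk _).subset fun v hv =>
        norm_le_of_stepSumDensity_ne_zero hk (hMN i) hR0 hR (x := latticePoint k v) ?_
      rw [hstep, latticeFloor_latticePoint hk]
      refine mul_ne_zero (by simp [hk.ne']) fun h0 => hv ?_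
      exact (congrArg ENNReal.toReal h0).trans ENNReal.toReal_zero
  simp only [hterm, mul_sub, Finset.sum_sub_distrib, ← Finset.sum_mul, hα, zero_mul, sub_zero]
  exact hdisc

/-! ### Truncation -/

/-- Writing `t = (t / s) * s` and using `0 ≤ negMulLog ≤ 1` on `[0, 1]`, the function `negMulLog`
is dominated on `[0, s]` in terms of its value at `s`. -/
theorem abs_negMulLog_le {s t : ℝ} (ht : 0 ≤ t) (hts : t ≤ s) :
    |Real.negMulLog t| ≤ s + |Real.negMulLog s| := by
  rcases ht.eq_or_lt with rfl | ht
  · simpa using add_nonneg hts (abs_nonneg _)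
  have hs : 0 < s := ht.trans_le hts
  set q := t / s with hq
  have hq0 : 0 < q := div_pos ht hs
  have hq1 : q ≤ 1 := (div_le_one hs).2 hts
  have e : t = q * s := (div_mul_cancel₀ t hs.ne').symm
  have h1 : 0 ≤ Real.negMulLog q := Real.negMulLog_nonneg hq0.le hq1
  have h2 : Real.negMulLog q ≤ 1 := by
    have h := mul_le_mul_of_nonneg_left (Real.one_sub_inv_le_log_of_pos hq0) hq0.le
    rw [mul_sub, mul_inv_cancel₀ hq0.ne'] at h
    simp only [Real.negMulLog]
    linarith
  rw [e, Real.negMulLog_mul]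
  refine (abs_add_le _ _).trans (add_le_add ?_ ?_)
  · rw [abs_of_nonneg (mul_nonneg hs.le h1)]
    exact mul_le_of_le_one_right hs.le h2
  · rw [abs_mul, abs_of_pos hq0]
    exact mul_le_of_le_one_left (abs_nonneg _) hq1

/-- The restriction of `f` to the set of `x` with `‖x‖ ≤ l` and `f x ≤ l`. -/
noncomputable def truncate {d : ℕ} (l : ℕ) (f : (Fin d → ℝ) → ℝ≥0∞) : (Fin d → ℝ) → ℝ≥0∞ :=
  {x | ‖x‖ ≤ l ∧ f x ≤ l}.indicator f

theorem measurable_truncate {d : ℕ} (l : ℕ) {f : (Fin d → ℝ) → ℝ≥0∞} (hf : Measurable f) :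
    Measurable (truncate l f) :=
  hf.indicator ((measurableSet_le measurable_norm measurable_const).inter
    (measurableSet_le hf measurable_const))

theorem truncate_le {d : ℕ} (l : ℕ) (f : (Fin d → ℝ) → ℝ≥0∞) (x : Fin d → ℝ) :
    truncate l f x ≤ f x :=
  indicator_le_self _ _ _

theorem truncate_le_natCast {d : ℕ} (l : ℕ) (f : (Fin d → ℝ) → ℝ≥0∞) (x : Fin d → ℝ) :
    truncate l f x ≤ l :=
  indicator_apply_le' (fun h => h.2) fun _ => zero_le

theorem norm_le_of_truncate_ne_zero {d l : ℕ} {f : (Fin d → ℝ) → ℝ≥0∞} {x : Fin d → ℝ}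
    (h : truncate l f x ≠ 0) : ‖x‖ ≤ l :=
  (mem_of_indicator_ne_zero h).1

theorem tendsto_truncate {d : ℕ} {f : (Fin d → ℝ) → ℝ≥0∞} {x : Fin d → ℝ} (hx : f x ≠ ∞) :
    Tendsto (fun l => truncate l f x) atTop (𝓝 (f x)) := by
  refine tendsto_const_nhds.congr' ?_
  obtain ⟨l₁, h₁⟩ := exists_nat_ge ‖x‖
  obtain ⟨l₂, h₂⟩ := ENNReal.exists_nat_gt hx
  filter_upwards [eventually_ge_atTop l₁, eventually_ge_atTop l₂] with l hl₁ hl₂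
  have hmem : x ∈ {x | ‖x‖ ≤ l ∧ f x ≤ l} :=
    ⟨h₁.trans (by exact_mod_cast hl₁), h₂.le.trans (by exact_mod_cast hl₂)⟩
  exact (indicator_of_mem hmem f).symm

theorem tendsto_lintegral_truncate {d : ℕ} {f : (Fin d → ℝ) → ℝ≥0∞} (hf : Measurable f)
    (hfin : ∫⁻ x, f x ≠ ∞) (hx : ∀ x, f x ≠ ∞) :
    Tendsto (fun l => ∫⁻ x, truncate l f x) atTop (𝓝 (∫⁻ x, f x)) :=
  tendsto_lintegral_of_dominated_convergence f (fun l => measurable_truncate l hf)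
    (fun l => Eventually.of_forall (truncate_le l f)) hfin
    (Eventually.of_forall fun x => tendsto_truncate (hx x))

theorem sumDensity_mono {r d : ℕ} (N : Matrix (Fin (r + 1)) (Fin (r + 1)) ℤ)
    {f g : Fin (r + 1) → (Fin d → ℝ) → ℝ≥0∞} (h : ∀ j x, f j x ≤ g j x) (x : Fin d → ℝ) :
    sumDensity N f x ≤ sumDensity N g x :=
  lintegral_mono fun _ => Finset.prod_le_prod' fun j _ => h j _

theorem sumDensity_const_mul {r d : ℕ} (N : Matrix (Fin (r + 1)) (Fin (r + 1)) ℤ)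
    {f : Fin (r + 1) → (Fin d → ℝ) → ℝ≥0∞} (hf : ∀ j, Measurable (f j))
    (c : Fin (r + 1) → ℝ≥0∞) (x : Fin d → ℝ) :
    sumDensity N (fun j x => c j * f j x) x = (∏ j, c j) * sumDensity N f x := by
  have hx : Measurable fun w : Fin r → Fin d → ℝ => (x, w) := measurable_prodMk_left
  have hm := (measurable_prod_comp_intMulVec_cons N hf).comp hx
  simp only [sumDensity, Finset.prod_mul_distrib]
  exact lintegral_const_mul _ hm

theorem tendsto_sumDensity_truncate {r d : ℕ} (N : Matrix (Fin (r + 1)) (Fin (r + 1)) ℤ)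
    {f : Fin (r + 1) → (Fin d → ℝ) → ℝ≥0∞} (hf : ∀ j, Measurable (f j))
    (hlt : ∀ j x, f j x ≠ ∞) {x : Fin d → ℝ} (hx : sumDensity N f x ≠ ∞) :
    Tendsto (fun l => sumDensity N (fun j => truncate l (f j)) x) atTop
      (𝓝 (sumDensity N f x)) := by
  have hpair : Measurable fun w : Fin r → Fin d → ℝ => (x, w) := measurable_prodMk_left
  refine tendsto_lintegral_of_dominated_convergence
    (fun w : Fin r → Fin d → ℝ =>
      ∏ j, f j (intMulVec N (Fin.cons x w : Fin (r + 1) → Fin d → ℝ) j))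
    (fun l => ?_) (fun l => Eventually.of_forall fun w =>
      Finset.prod_le_prod' fun j _ => truncate_le l (f j) _) hx
    (Eventually.of_forall fun w => ?_)
  · exact ((measurable_prod_comp_intMulVec_cons N
      fun j => measurable_truncate l (hf j)).comp hpair :)
  · exact ENNReal.tendsto_finsetProd_of_ne_top _ (fun j _ => tendsto_truncate (hlt j _))
      fun j _ => hlt j _

/-- Entropies of rescaled functions `b l * g l` converge when `b l → 1` and `g l → g` is
dominated by `g`. -/
theorem tendsto_integral_negMulLog_mul {E : Type*} [MeasurableSpace E] {μ : Measure E}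
    {b : ℕ → ℝ} (hb : Tendsto b atTop (𝓝 1)) {g : E → ℝ} {G : ℕ → E → ℝ}
    (hG : ∀ l, Measurable (G l)) (hG0 : ∀ l x, 0 ≤ G l x)
    (hGg : ∀ᵐ x ∂μ, ∀ l, G l x ≤ g x) (hlim : ∀ᵐ x ∂μ, Tendsto (fun l => G l x) atTop (𝓝 (g x)))
    (hg : Integrable g μ) (hent : Integrable (fun x => Real.negMulLog (g x)) μ) :
    Tendsto (fun l => ∫ x, Real.negMulLog (b l * G l x) ∂μ) atTop
      (𝓝 (∫ x, Real.negMulLog (g x) ∂μ)) := by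
  have hb' : Tendsto (fun l => |Real.negMulLog (b l)|) atTop (𝓝 0) := by
    simpa using ((Real.continuous_negMulLog.tendsto 1).comp hb).abs
  have hbabs : Tendsto (fun l => |b l|) atTop (𝓝 1) := by simpa using hb.abs
  refine tendsto_integral_filter_of_dominated_convergence
    (fun x => g x + 2 * (g x + |Real.negMulLog (g x)|)) ?_ ?_ ?_ ?_
  · exact Eventually.of_forall fun l => (Real.continuous_negMulLog.measurable.comp
      ((hG l).const_mul _)).aestronglyMeasurable
  · filter_upwards [hb'.eventually_le_const zero_lt_one,
      hbabs.eventually_le_const one_lt_two] with l h1 h2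
    filter_upwards [hGg] with x hx
    have h3 := abs_negMulLog_le (hG0 l x) (hx l)
    rw [Real.negMulLog_mul, Real.norm_eq_abs]
    refine (abs_add_le _ _).trans (add_le_add ?_ ?_)
    · rw [abs_mul, abs_of_nonneg (hG0 l x)]
      exact (mul_le_of_le_one_right (hG0 l x) h1).trans (hx l)
    · rw [abs_mul]
      exact mul_le_mul h2 h3 (abs_nonneg _) zero_le_two
  · exact hg.add ((hg.add hent.abs).const_mul 2)
  · filter_upwards [hlim] with x hx
    have := hb.mul hx
    rw [one_mul] at this
    exact (Real.continuous_negMulLog.tendsto _).comp this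

theorem lintegral_sumDensity {r d : ℕ} {M N : Matrix (Fin (r + 1)) (Fin (r + 1)) ℤ}
    (hMN : M * N = 1) (hNM : N * M = 1) {f : Fin (r + 1) → (Fin d → ℝ) → ℝ≥0∞}
    (hf : ∀ j, Measurable (f j)) (hone : ∀ j, ∫⁻ x, f j x = 1) :
    ∫⁻ x, sumDensity N f x = 1 := by
  have hprob := fun j => isProbabilityMeasure_withDensity (hone j)
  have h := congrArg (fun ν => ν univ) (map_sum_pi_withDensity hMN hNM hf)
  simp only [withDensity_apply _ MeasurableSet.univ, Measure.restrict_univ] at h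
  rw [← h, Measure.map_apply (by fun_prop) MeasurableSet.univ, preimage_univ, measure_univ]

/-- The differential inequality in terms of the densities of the summands. -/
theorem sum_integral_negMulLog_le {n r d : ℕ} (a : Fin n → Fin (r + 1) → ℤ)
    (α : Fin n → ℝ) (hα : ∑ i, α i = 0)
    (hdiscrete : ∀ (Ω : Type) [MeasurableSpace Ω] (P : Measure Ω) [IsProbabilityMeasure P]
      (U : Fin (r + 1) → Ω → (Fin d → ℤ)),
      (∀ j, Measurable (U j)) → iIndepFun U P →
      (∀ j, HasFiniteShannonEntropy (U j) P) →
      ∑ i, α i * shannonEntropy (fun ω => ∑ j, a i j • U j ω) P ≤ 0)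
    {M N : Fin n → Matrix (Fin (r + 1)) (Fin (r + 1)) ℤ} (hMN : ∀ i, M i * N i = 1)
    (hNM : ∀ i, N i * M i = 1) (hM : ∀ i, M i 0 = a i)
    {f : Fin (r + 1) → (Fin d → ℝ) → ℝ≥0∞} (hf : ∀ j, Measurable (f j))
    (hone : ∀ j, ∫⁻ x, f j x = 1) (hlt : ∀ j x, f j x ≠ ∞)
    (hent : ∀ i, Integrable fun x => Real.negMulLog (sumDensity (N i) f x).toReal) :
    ∑ i, α i * ∫ x, Real.negMulLog (sumDensity (N i) f x).toReal ≤ 0 := by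
  let c : ℕ → Fin (r + 1) → ℝ≥0∞ := fun l j => ∫⁻ x, truncate l (f j) x
  have hc : ∀ j, Tendsto (fun l => c l j) atTop (𝓝 1) := fun j => by
    have := tendsto_lintegral_truncate (hf j) (by simp [hone j]) (hlt j)
    rwa [hone j] at this
  have hctop : ∀ l j, c l j ≠ ∞ := fun l j =>
    ne_top_of_le_ne_top (by simp [hone j]) (lintegral_mono (truncate_le l (f j)))
  let b : ℕ → ℝ := fun l => (∏ j, (c l j)⁻¹).toReal
  have hb : Tendsto b atTop (𝓝 1) := by
    have h1 : Tendsto (fun l => ∏ j, (c l j)⁻¹) atTop (𝓝 (∏ _j : Fin (r + 1), (1 : ℝ≥0∞)⁻¹)) :=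
      ENNReal.tendsto_finsetProd_of_ne_top _ (fun j _ => (hc j).inv) fun j _ => by simp
    rw [Finset.prod_const, inv_one, one_pow] at h1
    have := (ENNReal.tendsto_toReal ENNReal.one_ne_top).comp h1
    rwa [ENNReal.toReal_one] at this
  have hfin : ∀ i, ∀ᵐ x, sumDensity (N i) f x < ∞ := fun i =>
    ae_lt_top (measurable_sumDensity (N i) hf)
      (by simp [lintegral_sumDensity (hMN i) (hNM i) hf hone])
  have hlim := tendsto_finsetSum Finset.univ fun i (_ : i ∈ Finset.univ) =>
    (tendsto_integral_negMulLog_mul (μ := volume) hb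
      (g := fun x => (sumDensity (N i) f x).toReal)
      (G := fun l x => (sumDensity (N i) (fun j => truncate l (f j)) x).toReal)
      (fun l => (measurable_sumDensity (N i) fun j => measurable_truncate l (hf j)).ennreal_toReal)
      (fun _ _ => ENNReal.toReal_nonneg)
      (by
        filter_upwards [hfin i] with x hx l
        exact ENNReal.toReal_mono hx.ne (sumDensity_mono _ (fun j => truncate_le l (f j)) x))
      (by
        filter_upwards [hfin i] with x hx
        exact (ENNReal.tendsto_toReal hx.ne).comp (tendsto_sumDensity_truncate _ hf hlt hx.ne))
      (integrable_toReal_of_lintegral_ne_top (measurable_sumDensity (N i) hf).aemeasurable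
        (by simp [lintegral_sumDensity (hMN i) (hNM i) hf hone]))
      (hent i)).const_mul (α i)
  refine le_of_tendsto hlim ?_
  have hpos : ∀ᶠ l in atTop, ∀ j, c l j ≠ 0 :=
    eventually_all.2 fun j => (hc j).eventually_ne one_ne_zero
  filter_upwards [hpos] with l hl
  -- A truncated density becomes a probability density after division by its total mass `c l j`.
  have h := sum_integral_negMulLog_le_of_bounded a α hα hdiscrete hMN hNM hM
    (f := fun j x => (c l j)⁻¹ * truncate l (f j) x)
    (fun j => (measurable_truncate l (hf j)).const_mul _)
    (fun j => by
      rw [lintegral_const_mul _ (measurable_truncate l (hf j))]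
      exact ENNReal.inv_mul_cancel (hl j) (hctop l j))
    (C := ∑ j, (c l j)⁻¹ * l)
    (ENNReal.sum_ne_top.2 fun j _ =>
      ENNReal.mul_ne_top (ENNReal.inv_ne_top.2 (hl j)) (ENNReal.natCast_ne_top l))
    (fun j x => (mul_le_mul_right (truncate_le_natCast l (f j) x) _).trans
      (Finset.single_le_sum (f := fun j => (c l j)⁻¹ * (l : ℝ≥0∞))
        (fun _ _ => zero_le) (Finset.mem_univ j)))
    (R := l) (Nat.cast_nonneg l)
    (fun j x hx => norm_le_of_truncate_ne_zero (right_ne_zero_of_mul hx))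
  simpa only [sumDensity_const_mul _ (fun j => measurable_truncate l (hf j)),
    ENNReal.toReal_mul] using h

/-! ### The continuous inequality -/

theorem theorem1 (n m d : ℕ) (a : Fin n → Fin m → ℤ) (α : Fin n → ℝ)
    (ha : ∀ i, Finset.univ.gcd (a i) = 1)
    (hα : ∑ i, α i = 0)
    (hdiscrete : ∀ (Ω : Type) [MeasurableSpace Ω] (P : Measure Ω) [IsProbabilityMeasure P]
      (U : Fin m → Ω → (Fin d → ℤ)),
      (∀ j, Measurable (U j)) → iIndepFun U P →
      (∀ j, HasFiniteShannonEntropy (U j) P) →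
      ∑ i, α i * shannonEntropy (fun ω => ∑ j, a i j • U j ω) P ≤ 0)
    {Ω : Type*} [MeasurableSpace Ω] (P : Measure Ω) [IsProbabilityMeasure P]
    (X : Fin m → Ω → (Fin d → ℝ))
    (hindep : iIndepFun X P)
    (hcont : ∀ j, HasPDF (X j) P volume)
    (hfin : ∀ i, HasFiniteDifferentialEntropy (fun ω => ∑ j, a i j • X j ω) P) :
    ∑ i, α i * differentialEntropy (fun ω => ∑ j, a i j • X j ω) P ≤ 0 := by
  rcases m with _ | r
  · -- The gcd of an empty row is `0`, so there are no rows.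
    have : IsEmpty (Fin n) := ⟨fun i => by simpa using ha i⟩
    simp
  choose M N hMN hNM hM using fun i => exists_unimodular_of_gcd_eq_one (a i) (ha i)
  -- Versions of the densities that are finite everywhere, not only almost everywhere.
  let f : Fin (r + 1) → (Fin d → ℝ) → ℝ≥0∞ := fun j x =>
    ENNReal.ofReal (pdf (X j) P volume x).toReal
  have hf : ∀ j, Measurable (f j) := fun j =>
    (measurable_pdf (X j) P volume).ennreal_toReal.ennreal_ofReal
  have hX : ∀ j, AEMeasurable (X j) P := fun j => (hcont j).aemeasurable
  have hlaw : ∀ j, P.map (X j) = volume.withDensity (f j) := fun j => by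
    rw [map_eq_withDensity_pdf (X j) P volume]
    exact withDensity_congr_ae (pdf.ofReal_toReal_ae_eq).symm
  have hone : ∀ j, ∫⁻ x, f j x = 1 := fun j => by
    have : IsProbabilityMeasure (P.map (X j)) := Measure.isProbabilityMeasure_map (hX j)
    rw [← Measure.restrict_univ (μ := volume), ← withDensity_apply _ MeasurableSet.univ, ← hlaw j,
      measure_univ]
  have hprob := fun j => isProbabilityMeasure_withDensity (hone j)
  have hjoint : P.map (fun ω j => X j ω) = Measure.pi fun j => volume.withDensity (f j) := by
    rw [(iIndepFun_iff_map_fun_eq_pi_map hX).1 hindep]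
    simp only [hlaw]
  have hpdf : ∀ i, pdf (fun ω => ∑ j, a i j • X j ω) P volume =ᵐ[volume]
      sumDensity (N i) f := fun i => by
    have hS : Measurable fun x : Fin (r + 1) → Fin d → ℝ => ∑ j, a i j • x j := by fun_prop
    have h : P.map (fun ω => ∑ j, a i j • X j ω) = volume.withDensity (sumDensity (N i) f) := by
      rw [← map_sum_pi_withDensity (hMN i) (hNM i) hf, ← hjoint, hM i,
        AEMeasurable.map_map_of_aemeasurable hS.aemeasurable (aemeasurable_pi_lambda _ hX)]
      rfl
    rw [pdf_def, h]
    exact Measure.rnDeriv_withDensity _ (measurable_sumDensity (N i) hf)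
  have hphi : ∀ i, (fun x => Real.negMulLog
      (pdf (fun ω => ∑ j, a i j • X j ω) P volume x).toReal) =ᵐ[volume]
      fun x => Real.negMulLog (sumDensity (N i) f x).toReal := fun i => by
    filter_upwards [hpdf i] with x hx
    rw [hx]
  have h := sum_integral_negMulLog_le a α hα hdiscrete hMN hNM hM hf hone
    (fun j x => ENNReal.ofReal_ne_top) fun i => (hfin i).congr (hphi i)
  refine le_of_eq_of_le (Finset.sum_congr rfl fun i _ => ?_) h
  rw [differentialEntropy, integral_congr_ae (hphi i)]
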